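/- **Setting.** Let $d\in\{2,3\}$ and let $\Omega\subset\mathbb R^d$ be a bounded, connected, non-empty open set equipped with a conforming simplicial triangulation $\mathcal T_h$: a finite simplicial complex, every face of which is a face of a $d$-simplex of the complex, with union $\overline\Omega$. (This covers every triangulated domain with polygonal, resp. Lipschitz polyhedral, boundary.) On $\mathbf H^1_0(\Omega)=(H^1_0(\Omega))^d$ use $$(\mathbf v,\mathbf w)_{\mathbf H^1_0(\Omega)}=\sum_{i,j=1}^d(\partial_jv_i,\partial_jw_i)_{L^2(\Omega)},\qquad \|\mathbf v\|_{\mathbf H^1_0(\Omega)}=(\mathbf v,\mathbf v)_{\mathbf H^1_0(\Omega)}^{1/2},$$ let $\mathbf H^{-1}(\Omega)$ be its dual, and $L^2_{zmv}(\Omega)=\{q\in L^2(\Omega):\int_\Omega q=0\}$. For $\mu>0$ put $$\|(\mathbf v,q)\|_{\mathcal X,\mu}=\big(\|\mathbf v\|^2_{\mathbf H^1_0(\Omega)}+\mu^{-2}\|q\|^2_{L^2(\Omega)}\big)^{1/2}.$$ Let $\nu>0$, $\lambda>0$ and $\mathbf f\in\mathbf H^{-1}(\Omega)$. Let $(\mathbf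 u,p)\in\mathbf H^1_0(\Omega)\times L^2_{zmv}(\Omega)$ be the solution of the Stokes problem $$\nu(\mathbf u,\mathbf v)_{\mathbf H^1_0(\Omega)}-(p,\operatorname{div}\mathbf v)_{L^2(\Omega)}=\langle\mathbf f,\mathbf v\rangle\ \ \forall\mathbf v\in\mathbf H^1_0(\Omega),\qquad (q,\operatorname{div}\mathbf u)_{L^2(\Omega)}=0\ \ \forall q\in L^2_{zmv}(\Omega),$$ and let $z_{\mathbf f}\in L^2_{zmv}(\Omega)$ be the pressure part of $\mathbf f$: $\mathbf f=-\Delta\mathbf w_{\mathbf f}+\nabla z_{\mathbf f}$, where $(\mathbf w_{\mathbf f},z_{\mathbf f})\in\mathbf H^1_0(\Omega)\times L^2_{zmv}(\Omega)$ solves the same problem with $\nu$ replaced by $1$. Let $k\ge1$. Let $P^{k-1}_{disc}(\mathcal T_h)$ be the space of $q\in L^2(\Omega)$ that are polynomials of degree at most $k-1$ on each $d$-simplex of $\mathcal T_h$, let $Q_h^{k-1}=P^{k-1}_{disc}(\mathcal T_h)\cap L^2_{zmv}(\Omega)$, and let $\mathbf V^k_{0,h}$ be the space of $\mathbf v\in\mathbf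 H^1_0(\Omega)$ whose components are polynomials of degree at most $k$ on each $d$-simplex of $\mathcal T_h$. Let $\Pi_{h,cg}$ be the $\mathbf L^2(\Omega)$-orthogonal projection onto $\mathbf V^k_{0,h}$ and $\Pi_{h,dg}$ the $L^2(\Omega)$-orthogonal projection onto $P^{k-1}_{disc}(\mathcal T_h)$. Given $p_h^{old}\in Q_h^{k-1}$, let $(\tilde{\mathbf u}_h,p_h^{new})\in\mathbf V^k_{0,h}\times Q_h^{k-1}$ be the solution of: for all $(\mathbf v_h,q_h)\in\mathbf V^k_{0,h}\times Q_h^{k-1}$, $$\nu\lambda(\tilde{\mathbf u}_h,\mathbf v_h)_{\mathbf H^1_0(\Omega)}-\lambda(p_h^{new},\operatorname{div}\mathbf v_h)_{L^2(\Omega)}=\lambda\langle\mathbf f,\mathbf v_h\rangle,$$ $$\lambda(q_h,\operatorname{div}\tilde{\mathbf u}_h)_{L^2(\Omega)}+\nu^{-1}(p_h^{new},q_h)_{L^2(\Omega)}=\nu^{-1}(p_h^{old},q_h)_{L^2(\Omega)}.$$ **Theorem.** Then $$\|(\tilde{\mathbf u}_h-\mathbf u,\,p_h^{new}-\Pi_{h,dg}z_{\mathbf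 f})\|_{\mathcal X,\sqrt\lambda\,\nu}\le\sqrt{1+d\lambda}\,\|\mathbf u-\Pi_{h,cg}\mathbf u\|_{\mathbf H^1_0(\Omega)}+(\sqrt\lambda\,\nu)^{-1}\|\Pi_{h,dg}z_{\mathbf f}-p_h^{old}\|_{L^2(\Omega)}.$$ If moreover every component of $\mathbf u$ is a polynomial of degree at most $k$ on $\Omega$, then $\Pi_{h,cg}\mathbf u=\mathbf u$ and $$\|(\tilde{\mathbf u}_h-\mathbf u,\,p_h^{new}-\Pi_{h,dg}z_{\mathbf f})\|_{\mathcal X,\sqrt\lambda\,\nu}\le(\sqrt\lambda\,\nu)^{-1}\|\Pi_{h,dg}z_{\mathbf f}-p_h^{old}\|_{L^2(\Omega)}.$$ -/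

import Mathlib

open MeasureTheory Set
open scoped ContDiff

noncomputable section

/-- The Euclidean space `ℝ^d`. -/
abbrev Rd (d : ℕ) : Type := EuclideanSpace ℝ (Fin d)

/-- The real Hilbert space `L²(Ω)`. -/
abbrev L2 {d : ℕ} (Ω : Set (Rd d)) : Type := Lp ℝ 2 (volume.restrict Ω)

/-- The real Hilbert space `L²(Ω)^d` of vector fields, with the inner product
`∑ i, (u i, v i)_{L²(Ω)}`. -/
abbrev L2Vec {d : ℕ} (Ω : Set (Rd d)) : Type := PiLp 2 (fun _ : Fin d => L2 Ω)

/-- `φ ∈ C_c^∞(Ω)`. -/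
structure IsTestFunction {d : ℕ} (Ω : Set (Rd d)) (φ : Rd d → ℝ) : Prop where
  smooth : ContDiff ℝ ∞ φ
  compact : HasCompactSupport φ
  support_subset : tsupport φ ⊆ Ω

/-- The classical partial derivative `∂_i φ` at `x`. -/
def partialDeriv {d : ℕ} (i : Fin d) (φ : Rd d → ℝ) (x : Rd d) : ℝ :=
  fderiv ℝ φ x (EuclideanSpace.single i 1)

/-- `g` is the weak partial derivative `∂_i v` on `Ω`. -/
def IsWeakPartial {d : ℕ} (Ω : Set (Rd d)) (i : Fin d) (v g : L2 Ω) : Prop :=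
  ∀ φ : Rd d → ℝ, IsTestFunction Ω φ →
    ∫ x in Ω, v x * partialDeriv i φ x = -∫ x in Ω, g x * φ x

theorem integrable_mul_of_compact {d : ℕ} {Ω : Set (Rd d)} (g : L2 Ω) {φ : Rd d → ℝ}
    (hφ : Continuous φ) (hc : HasCompactSupport φ) :
    Integrable (fun x => g x * φ x) (volume.restrict Ω) := by
  have hloc : LocallyIntegrable g (volume.restrict Ω) :=
    (Lp.memLp g).locallyIntegrable (by norm_num)
  simpa [mul_comm] using hloc.integrable_smul_left_of_hasCompactSupport hφ hc

theorem IsTestFunction.integrable_mul {d : ℕ} {Ω : Set (Rd d)} (g : L2 Ω) {φ : Rd d → ℝ}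
    (hφ : IsTestFunction Ω φ) : Integrable (fun x => g x * φ x) (volume.restrict Ω) :=
  integrable_mul_of_compact g hφ.smooth.continuous hφ.compact

theorem IsTestFunction.integrable_mul_partial {d : ℕ} {Ω : Set (Rd d)} (g : L2 Ω)
    {φ : Rd d → ℝ} (hφ : IsTestFunction Ω φ) (i : Fin d) :
    Integrable (fun x => g x * partialDeriv i φ x) (volume.restrict Ω) :=
  integrable_mul_of_compact g
    ((hφ.smooth.continuous_fderiv (by simp)).clm_apply continuous_const)
    (hφ.compact.fderiv_apply (𝕜 := ℝ) _)

theorem IsWeakPartial.add {d : ℕ} {Ω : Set (Rd d)} {i : Fin d} {v w g h : L2 Ω}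
    (hv : IsWeakPartial Ω i v g) (hw : IsWeakPartial Ω i w h) :
    IsWeakPartial Ω i (v + w) (g + h) := by
  intro φ hφ
  have e1 : ∫ x in Ω, (v + w : L2 Ω) x * partialDeriv i φ x =
      ∫ x in Ω, (v x * partialDeriv i φ x + w x * partialDeriv i φ x) := by
    refine integral_congr_ae ?_
    filter_upwards [Lp.coeFn_add v w] with x hx
    rw [hx, Pi.add_apply, add_mul]
  have e2 : ∫ x in Ω, (g + h : L2 Ω) x * φ x = ∫ x in Ω, (g x * φ x + h x * φ x) := by
    refine integral_congr_ae ?_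
    filter_upwards [Lp.coeFn_add g h] with x hx
    rw [hx, Pi.add_apply, add_mul]
  rw [e1, e2, integral_add (hφ.integrable_mul_partial v i) (hφ.integrable_mul_partial w i),
    integral_add (hφ.integrable_mul g) (hφ.integrable_mul h), hv φ hφ, hw φ hφ]
  ring

theorem IsWeakPartial.smul {d : ℕ} {Ω : Set (Rd d)} {i : Fin d} {v g : L2 Ω} (c : ℝ)
    (hv : IsWeakPartial Ω i v g) : IsWeakPartial Ω i (c • v) (c • g) := by
  intro φ hφ
  have e1 : ∫ x in Ω, (c • v : L2 Ω) x * partialDeriv i φ x =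
      ∫ x in Ω, c * (v x * partialDeriv i φ x) := by
    refine integral_congr_ae ?_
    filter_upwards [Lp.coeFn_smul c v] with x hx
    rw [hx, Pi.smul_apply, smul_eq_mul, mul_assoc]
  have e2 : ∫ x in Ω, (c • g : L2 Ω) x * φ x = ∫ x in Ω, c * (g x * φ x) := by
    refine integral_congr_ae ?_
    filter_upwards [Lp.coeFn_smul c g] with x hx
    rw [hx, Pi.smul_apply, smul_eq_mul, mul_assoc]
  rw [e1, e2, integral_const_mul, integral_const_mul, hv φ hφ]
  ring

theorem IsWeakPartial.zero {d : ℕ} {Ω : Set (Rd d)} {i : Fin d} :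
    IsWeakPartial Ω i (0 : L2 Ω) 0 := by
  intro φ _
  have e : ∀ ψ : Rd d → ℝ, ∫ x in Ω, (0 : L2 Ω) x * ψ x = 0 := fun ψ => by
    refine integral_eq_zero_of_ae ?_
    filter_upwards [Lp.coeFn_zero ℝ 2 (volume.restrict Ω)] with x hx
    rw [Pi.zero_apply] at hx
    exact mul_eq_zero_of_left hx _
  rw [e, e, neg_zero]

/-- On an open set a weak partial derivative is unique. -/
theorem IsWeakPartial.unique {d : ℕ} {Ω : Set (Rd d)} (hΩ : IsOpen Ω) {i : Fin d}
    {v g₁ g₂ : L2 Ω} (h₁ : IsWeakPartial Ω i v g₁) (h₂ : IsWeakPartial Ω i v g₂) : g₁ = g₂ := by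
  have hloc : ∀ g : L2 Ω, LocallyIntegrable g (volume.restrict Ω) := fun g =>
    (Lp.memLp g).locallyIntegrable (by norm_num)
  have key : ∀ᵐ x ∂(volume.restrict Ω), x ∈ Ω → g₁ x - g₂ x = 0 := by
    refine hΩ.ae_eq_zero_of_integral_contDiff_smul_eq_zero (f := fun x => g₁ x - g₂ x)
      (((hloc g₁).sub (hloc g₂)).locallyIntegrableOn _) ?_
    intro φ h1 h2 h3
    have hφ : IsTestFunction Ω φ := ⟨h1, h2, h3⟩
    have e : ∫ x in Ω, g₁ x * φ x = ∫ x in Ω, g₂ x * φ x := by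
      have a := h₁ φ hφ
      have b := h₂ φ hφ
      linarith
    have : ∀ x, φ x • (g₁ x - g₂ x) = g₁ x * φ x - g₂ x * φ x := fun x => by
      simp only [smul_eq_mul]; ring
    simp_rw [this]
    rw [integral_sub (hφ.integrable_mul _) (hφ.integrable_mul _), e, sub_self]
  apply Lp.ext
  filter_upwards [key, ae_restrict_mem hΩ.measurableSet] with x hx hxΩ
  linarith [hx hxΩ]

open Classical in
/-- The weak partial derivative `∂_i v ∈ L²(Ω)` (and `0` if there is none). -/
def weakPartial {d : ℕ} {Ω : Set (Rd d)} (i : Fin d) (v : L2 Ω) : L2 Ω :=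
  if h : ∃ g : L2 Ω, IsWeakPartial Ω i v g then h.choose else 0

theorem isWeakPartial_weakPartial {d : ℕ} {Ω : Set (Rd d)} {i : Fin d} {v g : L2 Ω}
    (h : IsWeakPartial Ω i v g) : IsWeakPartial Ω i v (weakPartial i v) := by
  have hex : ∃ g : L2 Ω, IsWeakPartial Ω i v g := ⟨g, h⟩
  rw [weakPartial, dif_pos hex]
  exact hex.choose_spec

/-- `H¹(Ω)`. -/
def H1 {d : ℕ} (Ω : Set (Rd d)) : Submodule ℝ (L2 Ω) where
  carrier := {v | ∀ i, ∃ g : L2 Ω, IsWeakPartial Ω i v g}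
  zero_mem' := fun _ => ⟨0, IsWeakPartial.zero⟩
  add_mem' := fun ha hb i => by
    obtain ⟨g, hg⟩ := ha i
    obtain ⟨h, hh⟩ := hb i
    exact ⟨g + h, hg.add hh⟩
  smul_mem' := fun c _ ha i => by
    obtain ⟨g, hg⟩ := ha i
    exact ⟨c • g, hg.smul c⟩

theorem IsTestFunction.add {d : ℕ} {Ω : Set (Rd d)} {φ ψ : Rd d → ℝ}
    (hφ : IsTestFunction Ω φ) (hψ : IsTestFunction Ω ψ) : IsTestFunction Ω (φ + ψ) :=
  ⟨hφ.smooth.add hψ.smooth, hφ.compact.add hψ.compact,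
    (tsupport_add φ ψ).trans (union_subset hφ.support_subset hψ.support_subset)⟩

theorem IsTestFunction.smul {d : ℕ} {Ω : Set (Rd d)} {φ : Rd d → ℝ} (c : ℝ)
    (hφ : IsTestFunction Ω φ) : IsTestFunction Ω (c • φ) :=
  ⟨hφ.smooth.const_smul c, hφ.compact.smul_left (f := fun _ => c),
    (tsupport_smul_subset_right (fun _ => c) φ).trans hφ.support_subset⟩

/-- The pairs `(φ, ∇φ)` with `φ ∈ C_c^∞(Ω)`, in `L²(Ω) × L²(Ω)^d`. -/
def testGraph {d : ℕ} (Ω : Set (Rd d)) : Submodule ℝ (L2 Ω × L2Vec Ω) where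
  carrier := {w | ∃ φ : Rd d → ℝ, IsTestFunction Ω φ ∧ w.1 =ᵐ[volume.restrict Ω] φ ∧
    ∀ i, w.2 i =ᵐ[volume.restrict Ω] partialDeriv i φ}
  zero_mem' := by
    refine ⟨0, ⟨contDiff_const, HasCompactSupport.zero, by simp [tsupport]⟩,
      Lp.coeFn_zero _ _ _, fun i => ?_⟩
    filter_upwards [Lp.coeFn_zero ℝ 2 (volume.restrict Ω)] with x hx
    simpa [partialDeriv] using hx
  add_mem' := by
    rintro a b ⟨φ, hφ, h1, h2⟩ ⟨ψ, hψ, h3, h4⟩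
    refine ⟨φ + ψ, hφ.add hψ, ?_, fun i => ?_⟩
    · filter_upwards [Lp.coeFn_add a.1 b.1, h1, h3] with x e h1 h3
      simpa [h1, h3] using e
    · filter_upwards [Lp.coeFn_add (a.2 i) (b.2 i), h2 i, h4 i] with x e h2 h4
      have : partialDeriv i (φ + ψ) x = partialDeriv i φ x + partialDeriv i ψ x := by
        unfold partialDeriv
        rw [fderiv_add (hφ.smooth.differentiable (by simp) x)
          (hψ.smooth.differentiable (by simp) x)]
        rfl
      rw [this, ← h2, ← h4]
      simpa using e
  smul_mem' := by
    rintro c a ⟨φ, hφ, h1, h2⟩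
    refine ⟨c • φ, hφ.smul c, ?_, fun i => ?_⟩
    · filter_upwards [Lp.coeFn_smul c a.1, h1] with x e h1
      simpa [h1] using e
    · filter_upwards [Lp.coeFn_smul c (a.2 i), h2 i] with x e h2
      have : partialDeriv i (c • φ) x = c * partialDeriv i φ x := by
        unfold partialDeriv
        rw [fderiv_const_smul (hφ.smooth.differentiable (by simp) x)]
        rfl
      rw [this, ← h2]
      simpa using e

/-- `H¹₀(Ω)`, the closure of `C_c^∞(Ω)` for the norm of `H¹(Ω)`: the first components of the
closure in `L²(Ω) × L²(Ω)^d` of the pairs `(φ, ∇φ)`, `φ ∈ C_c^∞(Ω)`. -/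
def H10 {d : ℕ} (Ω : Set (Rd d)) : Submodule ℝ (L2 Ω) :=
  (testGraph Ω).topologicalClosure.map (LinearMap.fst ℝ (L2 Ω) (L2Vec Ω))

/-- `H¹₀(Ω)^d`. -/
def H10Vec {d : ℕ} (Ω : Set (Rd d)) : Submodule ℝ (L2Vec Ω) where
  carrier := {v | ∀ i, v i ∈ H10 Ω}
  zero_mem' := fun _ => (H10 Ω).zero_mem
  add_mem' := fun ha hb i => (H10 Ω).add_mem (ha i) (hb i)
  smul_mem' := fun c _ ha i => (H10 Ω).smul_mem c (ha i)

/-- The inner product `∑ i j, (∂_j v_i, ∂_j w_i)_{L²(Ω)}` of `H¹₀(Ω)^d`. -/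
def h10Inner {d : ℕ} {Ω : Set (Rd d)} (v w : L2Vec Ω) : ℝ :=
  ∑ i, ∑ j, inner ℝ (weakPartial j (v i)) (weakPartial j (w i))

/-- The norm `(∑ i j, ‖∂_j v_i‖²)^{1/2}` of `H¹₀(Ω)^d`. -/
def h10Norm {d : ℕ} {Ω : Set (Rd d)} (v : L2Vec Ω) : ℝ :=
  √(∑ i, ∑ j, ‖weakPartial j (v i)‖ ^ 2)

/-- The divergence `∑ i, ∂_i v_i`. -/
def divergence {d : ℕ} {Ω : Set (Rd d)} (v : L2Vec Ω) : L2 Ω :=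
  ∑ i, weakPartial i (v i)

/-- `L²_zmv(Ω)`: the elements of `L²(Ω)` of mean value zero. -/
def L2zmv {d : ℕ} (Ω : Set (Rd d)) : Set (L2 Ω) :=
  {q | ∫ x in Ω, q x = 0}

/-- `H⁻¹(Ω)^d`: the linear forms on `H¹₀(Ω)^d` that are continuous for its norm. -/
def HNegOneVec {d : ℕ} (Ω : Set (Rd d)) : Set (Module.Dual ℝ (H10Vec Ω)) :=
  {f | ∃ C : ℝ, ∀ v : H10Vec Ω, |f v| ≤ C * h10Norm (v : L2Vec Ω)}

/-- `(u, p) ∈ H¹₀(Ω)^d × L²_zmv(Ω)` solves the weak form of the homogeneous Dirichlet problem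
`-ν Δu + ∇p = f`, `div u = 0`. -/
structure IsStokesSolution {d : ℕ} (Ω : Set (Rd d)) (ν : ℝ) (f : Module.Dual ℝ (H10Vec Ω))
    (u : L2Vec Ω) (p : L2 Ω) : Prop where
  velocity_mem : u ∈ H10Vec Ω
  pressure_mem : p ∈ L2zmv Ω
  momentum : ∀ v : H10Vec Ω,
    ν * h10Inner u (v : L2Vec Ω) - inner ℝ p (divergence (v : L2Vec Ω)) = f v
  mass : ∀ q ∈ L2zmv Ω, inner ℝ q (divergence u) = 0

/-- A (conforming) simplicial triangulation of `Ω`: a finite simplicial complex all of whose faces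
are faces of `d`-simplices of the complex, and which fills the closure of `Ω`. -/
structure Triangulation {d : ℕ} (Ω : Set (Rd d)) where
  complex : Geometry.SimplicialComplex ℝ (Rd d)
  finite_faces : complex.faces.Finite
  pure : ∀ s ∈ complex.faces, ∃ t ∈ complex.faces, s ⊆ t ∧ t.card = d + 1
  space_eq : complex.space = closure Ω

/-- The vertex sets of the `d`-simplices of the triangulation. -/
def Triangulation.cells {d : ℕ} {Ω : Set (Rd d)} (𝒯 : Triangulation Ω) : Set (Finset (Rd d)) :=
  {s | s ∈ 𝒯.complex.faces ∧ s.card = d + 1}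

/-- The value at `x` of a real polynomial in `d` variables. -/
def polyEval {d : ℕ} (P : MvPolynomial (Fin d) ℝ) (x : Rd d) : ℝ :=
  MvPolynomial.eval (fun i => x i) P

/-- `q` coincides on `D ∩ Ω` with a polynomial of (total) degree at most `k`. -/
def IsPolyOn {d : ℕ} {Ω : Set (Rd d)} (k : ℕ) (D : Set (Rd d)) (q : L2 Ω) : Prop :=
  ∃ P ∈ MvPolynomial.restrictTotalDegree (Fin d) ℝ k,
    ∀ᵐ x ∂(volume.restrict Ω), x ∈ D → q x = polyEval P x

/-- `P^k_disc(𝒯)`: the elements of `L²(Ω)` that are polynomials of degree at most `k` on each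
simplex. -/
def Pdisc {d : ℕ} {Ω : Set (Rd d)} (𝒯 : Triangulation Ω) (k : ℕ) : Submodule ℝ (L2 Ω) where
  carrier := {q | ∀ s ∈ 𝒯.cells, IsPolyOn k (convexHull ℝ (s : Set (Rd d))) q}
  zero_mem' := by
    intro s _
    refine ⟨0, Submodule.zero_mem _, ?_⟩
    filter_upwards [Lp.coeFn_zero ℝ 2 (volume.restrict Ω)] with x hx _
    simpa [polyEval] using hx
  add_mem' := by
    intro a b ha hb s hs
    obtain ⟨P, hP, h1⟩ := ha s hs
    obtain ⟨Q, hQ, h2⟩ := hb s hs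
    refine ⟨P + Q, Submodule.add_mem _ hP hQ, ?_⟩
    filter_upwards [Lp.coeFn_add a b, h1, h2] with x e h1 h2 hx
    rw [e, Pi.add_apply, h1 hx, h2 hx]
    simp [polyEval]
  smul_mem' := by
    intro c a ha s hs
    obtain ⟨P, hP, h1⟩ := ha s hs
    refine ⟨c • P, Submodule.smul_mem _ c hP, ?_⟩
    filter_upwards [Lp.coeFn_smul c a, h1] with x e h1 hx
    rw [e, Pi.smul_apply, h1 hx]
    simp [polyEval, MvPolynomial.smul_eval]

theorem continuous_polyEval {d : ℕ} (P : MvPolynomial (Fin d) ℝ) :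
    Continuous (polyEval P : Rd d → ℝ) :=
  (MvPolynomial.continuous_eval P).comp (by fun_prop)

/-- Polynomials as almost-everywhere classes. -/
def polyToAE {d : ℕ} (μ : Measure (Rd d)) : MvPolynomial (Fin d) ℝ →ₗ[ℝ] (Rd d →ₘ[μ] ℝ) where
  toFun P := AEEqFun.mk (polyEval P) (continuous_polyEval P).aestronglyMeasurable
  map_add' P Q := by
    rw [AEEqFun.mk_add_mk]
    congr 1
    funext x
    simp [polyEval]
  map_smul' c P := by
    rw [RingHom.id_apply, AEEqFun.smul_mk]
    congr 1
    funext x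
    simp [polyEval, MvPolynomial.smul_eval]

/-- Restriction of almost-everywhere classes to a subset. -/
def restrictAE {d : ℕ} {Ω : Set (Rd d)} (D : Set (Rd d)) :
    L2 Ω →ₗ[ℝ] (Rd d →ₘ[(volume.restrict Ω).restrict D] ℝ) where
  toFun q := AEEqFun.mk q (Lp.aestronglyMeasurable q).restrict
  map_add' a b := by
    rw [AEEqFun.mk_add_mk, AEEqFun.mk_eq_mk]
    exact ae_restrict_of_ae (Lp.coeFn_add a b)
  map_smul' c a := by
    rw [RingHom.id_apply, AEEqFun.smul_mk, AEEqFun.mk_eq_mk]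
    exact ae_restrict_of_ae (Lp.coeFn_smul c a)

instance Pdisc.finiteDimensional {d : ℕ} {Ω : Set (Rd d)} (𝒯 : Triangulation Ω) (k : ℕ) :
    FiniteDimensional ℝ (Pdisc 𝒯 k) := by
  have hfin : 𝒯.cells.Finite := 𝒯.finite_faces.subset fun s hs => hs.1
  have : Finite 𝒯.cells := hfin.to_subtype
  have : Countable 𝒯.cells := Finite.to_countable
  let μ : 𝒯.cells → Measure (Rd d) := fun s =>
    (volume.restrict Ω).restrict (convexHull ℝ ((s : Finset (Rd d)) : Set (Rd d)))
  have hmeas : ∀ s : 𝒯.cells,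
      MeasurableSet (convexHull ℝ ((s : Finset (Rd d)) : Set (Rd d))) := fun s =>
    ((s : Finset (Rd d)).finite_toSet.isCompact_convexHull ℝ).measurableSet
  let Φ : L2 Ω →ₗ[ℝ] (∀ s : 𝒯.cells, (Rd d →ₘ[μ s] ℝ)) :=
    LinearMap.pi fun s => restrictAE (convexHull ℝ ((s : Finset (Rd d)) : Set (Rd d)))
  let Ψ : (𝒯.cells → MvPolynomial.restrictTotalDegree (Fin d) ℝ k) →ₗ[ℝ]
      (∀ s : 𝒯.cells, (Rd d →ₘ[μ s] ℝ)) :=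
    LinearMap.pi fun s => (polyToAE (μ s)).comp ((Submodule.subtype _).comp (LinearMap.proj s))
  have hinj : Function.Injective Φ := by
    intro a b hab
    apply Lp.ext
    have h : ∀ s : 𝒯.cells, ∀ᵐ x ∂(volume.restrict Ω),
        x ∈ convexHull ℝ ((s : Finset (Rd d)) : Set (Rd d)) → a x = b x := fun s => by
      have := congrFun hab s
      have := AEEqFun.mk_eq_mk.1 this
      exact (ae_restrict_iff' (hmeas s)).1 this
    have hcov : ∀ᵐ x ∂(volume.restrict Ω), x ∈ closure Ω :=
      ae_mono (MeasureTheory.Measure.restrict_mono subset_closure le_rfl)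
        (ae_restrict_mem isClosed_closure.measurableSet)
    filter_upwards [ae_all_iff.2 h, hcov] with x hx hxΩ
    rw [← 𝒯.space_eq] at hxΩ
    obtain ⟨s, hs, hxs⟩ := Geometry.SimplicialComplex.mem_space_iff.1 hxΩ
    obtain ⟨t, ht, hst, hc⟩ := 𝒯.pure s hs
    exact hx ⟨t, ht, hc⟩ (convexHull_mono (by exact_mod_cast hst) hxs)
  have hle : (Pdisc 𝒯 k).map Φ ≤ LinearMap.range Ψ := by
    rintro _ ⟨q, hq, rfl⟩
    choose P hP h using fun s : 𝒯.cells => hq s s.2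
    refine ⟨fun s => ⟨P s, hP s⟩, ?_⟩
    funext s
    symm
    refine AEEqFun.mk_eq_mk.2 ?_
    exact (ae_restrict_iff' (hmeas s)).2 (h s)
  have : FiniteDimensional ℝ ((Pdisc 𝒯 k).map Φ) := Submodule.finiteDimensional_of_le hle
  exact ((Pdisc 𝒯 k).equivMapOfInjective Φ hinj).symm.finiteDimensional

/-- The Lagrange space `V_h^k = {v ∈ H¹(Ω) : v|_T ∈ P^k(T) for every simplex T}`. -/
def Vh {d : ℕ} {Ω : Set (Rd d)} (𝒯 : Triangulation Ω) (k : ℕ) : Submodule ℝ (L2 Ω) :=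
  H1 Ω ⊓ Pdisc 𝒯 k

/-- `V_{0,h}^k`: the elements of `V_h^k` that vanish on the boundary, i.e. that lie in `H¹₀(Ω)`. -/
def Vh0 {d : ℕ} {Ω : Set (Rd d)} (𝒯 : Triangulation Ω) (k : ℕ) : Submodule ℝ (L2 Ω) :=
  Vh 𝒯 k ⊓ H10 Ω

/-- `(V_{0,h}^k)^d`. -/
def Vh0Vec {d : ℕ} {Ω : Set (Rd d)} (𝒯 : Triangulation Ω) (k : ℕ) :
    Submodule ℝ (L2Vec Ω) where
  carrier := {v | ∀ i, v i ∈ Vh0 𝒯 k}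
  zero_mem' := fun _ => (Vh0 𝒯 k).zero_mem
  add_mem' := fun ha hb i => (Vh0 𝒯 k).add_mem (ha i) (hb i)
  smul_mem' := fun c _ ha i => (Vh0 𝒯 k).smul_mem c (ha i)

instance Vh0Vec.finiteDimensional {d : ℕ} {Ω : Set (Rd d)} (𝒯 : Triangulation Ω) (k : ℕ) :
    FiniteDimensional ℝ (Vh0Vec 𝒯 k) := by
  have h0 : FiniteDimensional ℝ (Vh0 𝒯 k) :=
    Submodule.finiteDimensional_of_le (S₂ := Pdisc 𝒯 k)
      (inf_le_left.trans inf_le_right)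
  let F : Vh0Vec 𝒯 k →ₗ[ℝ] (Fin d → Vh0 𝒯 k) :=
    { toFun := fun v i => ⟨(v : L2Vec Ω) i, v.2 i⟩
      map_add' := fun _ _ => rfl
      map_smul' := fun _ _ => rfl }
  refine FiniteDimensional.of_injective F fun a b hab => ?_
  apply Subtype.ext
  ext1 i
  exact congrArg Subtype.val (congrFun hab i)

/-- `Q_h^k = P^k_disc(𝒯) ∩ L²_zmv(Ω)`. -/
def Qh {d : ℕ} {Ω : Set (Rd d)} (𝒯 : Triangulation Ω) (k : ℕ) : Set (L2 Ω) :=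
  (Pdisc 𝒯 k : Set (L2 Ω)) ∩ L2zmv Ω

/-- The `L²(Ω)^d`-orthogonal projection onto `(V_{0,h}^k)^d`. -/
def projCG {d : ℕ} {Ω : Set (Rd d)} (𝒯 : Triangulation Ω) (k : ℕ) (v : L2Vec Ω) : L2Vec Ω :=
  (Vh0Vec 𝒯 k).starProjection v

/-- The `L²(Ω)`-orthogonal projection onto `P^k_disc(𝒯)`. -/
def projDG {d : ℕ} {Ω : Set (Rd d)} (𝒯 : Triangulation Ω) (k : ℕ) (q : L2 Ω) : L2 Ω :=
  (Pdisc 𝒯 k).starProjection q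

/-- The norm `(‖v‖²_{H¹₀(Ω)^d} + μ⁻² ‖q‖²_{L²(Ω)})^{1/2}`. -/
def pairNorm {d : ℕ} {Ω : Set (Rd d)} (μ : ℝ) (v : L2Vec Ω) (q : L2 Ω) : ℝ :=
  √(h10Norm v ^ 2 + (μ ^ 2)⁻¹ * ‖q‖ ^ 2)

/-- `(u, p)` solves the `P^k × P^{k-1}_disc` discretization with parameter `lam`, right-hand
side `f` and pressure guess `pOld`. -/
structure IsDiscreteSolution {d : ℕ} {Ω : Set (Rd d)} (𝒯 : Triangulation Ω) (k : ℕ)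
    (ν lam : ℝ) (f : Module.Dual ℝ (H10Vec Ω)) (pOld : L2 Ω) (u : L2Vec Ω) (p : L2 Ω) :
    Prop where
  velocity_mem : u ∈ Vh0Vec 𝒯 k
  pressure_mem : p ∈ Qh 𝒯 (k - 1)
  momentum : ∀ v : H10Vec Ω, (v : L2Vec Ω) ∈ Vh0Vec 𝒯 k →
    ν * lam * h10Inner u (v : L2Vec Ω) - lam * inner ℝ p (divergence (v : L2Vec Ω)) = lam * f v
  mass : ∀ q ∈ Qh 𝒯 (k - 1),
    lam * inner ℝ q (divergence u) + ν⁻¹ * inner ℝ p q = ν⁻¹ * inner ℝ pOld q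

end

/-! The Stokes velocity scales like `1/ν`: the decomposition of `f` has velocity part `w` with `∇w =
ν∇u`, so `f(φ) = ν(∇u, ∇φ) - (z, div φ)` (`IsStokesSolution.weakGrad_eq_smul`). For a discrete `φ`,
`div φ` is piecewise polynomial of degree at most `k - 1` (`divergence_mem_Pdisc`), so `z` may be
replaced there by its projection `Πz`. With `r = pNew - Πz`, the discrete momentum equation becomes
the orthogonality `ν(∇(uh - u), ∇φ) = (r, div φ)`.

Testing it with `φ = uh - v`, `v` any discrete velocity, and testing the mass equation with `r`,
makes the coupling `(r, div uh)` cancel, because `div u` is orthogonal to `r`. What remains is an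
energy identity (`IsDiscreteSolution.error_identity`) whose right-hand side is linear in the error.
The term `ν⁻¹‖r‖²` controls the pressure, so no inf-sup condition enters. Cauchy–Schwarz, `‖div v‖ ≤
√d ‖∇v‖` and an elementary inequality in the plane give the constant `√(1 + dλ)`. The choice `v =
Πu` is the theorem. -/

/-! ### Polynomial functions and their derivatives -/

theorem polyEval_C {d : ℕ} (a : ℝ) :
    (polyEval (MvPolynomial.C a) : Rd d → ℝ) = fun _ => a := by
  funext y; simp [polyEval]

theorem polyEval_X {d : ℕ} (i : Fin d) :
    (polyEval (MvPolynomial.X i) : Rd d → ℝ) = EuclideanSpace.proj (𝕜 := ℝ) i := by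
  funext y; simp [polyEval]

theorem polyEval_add {d : ℕ} (P Q : MvPolynomial (Fin d) ℝ) :
    (polyEval (P + Q) : Rd d → ℝ) = polyEval P + polyEval Q := by
  funext y; simp [polyEval]

theorem polyEval_mul {d : ℕ} (P Q : MvPolynomial (Fin d) ℝ) :
    (polyEval (P * Q) : Rd d → ℝ) = polyEval P * polyEval Q := by
  funext y; simp [polyEval]

theorem contDiff_polyEval {d : ℕ} (P : MvPolynomial (Fin d) ℝ) :
    ContDiff ℝ ∞ (polyEval P : Rd d → ℝ) := by
  induction P using MvPolynomial.induction_on with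
  | C a => rw [polyEval_C]; exact contDiff_const
  | add P Q hP hQ => rw [polyEval_add]; exact hP.add hQ
  | mul_X P i hP =>
    rw [polyEval_mul, polyEval_X]
    exact hP.mul (ContinuousLinearMap.contDiff _)

theorem partialDeriv_polyEval {d : ℕ} (i : Fin d) (P : MvPolynomial (Fin d) ℝ) (x : Rd d) :
    partialDeriv i (polyEval P) x = polyEval (MvPolynomial.pderiv i P) x := by
  have hdiff : ∀ Q : MvPolynomial (Fin d) ℝ, DifferentiableAt ℝ (polyEval Q) x := fun Q =>
    (contDiff_polyEval Q).differentiable (by simp) x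
  unfold partialDeriv
  induction P using MvPolynomial.induction_on with
  | C a => simp [polyEval_C, polyEval]
  | add P Q hP hQ =>
    rw [polyEval_add, fderiv_add (hdiff P) (hdiff Q), add_apply, hP, hQ, map_add, polyEval_add,
      Pi.add_apply]
  | mul_X P j hP =>
    rw [polyEval_mul, fderiv_mul (hdiff P) (hdiff _), add_apply, smul_apply, smul_apply, hP,
      polyEval_X, ContinuousLinearMap.fderiv]
    rcases eq_or_ne i j with rfl | hij
    · simp [polyEval]
    · simp [polyEval, hij.symm]

/-- The coefficient of `∂_i P` at `m` is a multiple of that of `P` at `m + e_i`, a monomial of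
degree one more. For `k = 0` no such monomial exists, so the truncated `k - 1 = 0` is harmless. -/
theorem pderiv_mem_restrictTotalDegree {σ R : Type*} [CommSemiring R] {k : ℕ} (i : σ)
    {P : MvPolynomial σ R} (hP : P ∈ MvPolynomial.restrictTotalDegree σ R k) :
    MvPolynomial.pderiv i P ∈ MvPolynomial.restrictTotalDegree σ R (k - 1) := by
  rw [MvPolynomial.mem_restrictTotalDegree] at hP ⊢
  refine Finset.sup_le fun m hm => ?_
  rw [MvPolynomial.mem_support_iff, MvPolynomial.coeff_pderiv] at hm
  have hm' : m + Finsupp.single i 1 ∈ P.support :=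
    MvPolynomial.mem_support_iff.2 (left_ne_zero_of_mul hm)
  have h := (MvPolynomial.le_totalDegree hm').trans hP
  rw [Finsupp.sum_add_index' (by simp) (by simp), Finsupp.sum_single_index (by simp)] at h
  omega

/-! ### Integration by parts against test functions -/

theorem partialDeriv_eq_zero_of_notMem_tsupport {d : ℕ} {i : Fin d} {φ : Rd d → ℝ} {x : Rd d}
    (hx : x ∉ tsupport φ) : partialDeriv i φ x = 0 := by
  have : fderiv ℝ φ x = 0 := by
    by_contra h
    exact hx (support_fderiv_subset ℝ h)
  simp [partialDeriv, this]

theorem IsTestFunction.mono {d : ℕ} {U Ω : Set (Rd d)} (hU : U ⊆ Ω) {φ : Rd d → ℝ}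
    (hφ : IsTestFunction U φ) : IsTestFunction Ω φ :=
  ⟨hφ.smooth, hφ.compact, hφ.support_subset.trans hU⟩

theorem IsTestFunction.continuous_partialDeriv {d : ℕ} {Ω : Set (Rd d)} {φ : Rd d → ℝ}
    (hφ : IsTestFunction Ω φ) (i : Fin d) : Continuous (partialDeriv i φ) :=
  (hφ.smooth.continuous_fderiv (by simp)).clm_apply continuous_const

theorem IsTestFunction.hasCompactSupport_partialDeriv {d : ℕ} {Ω : Set (Rd d)} {φ : Rd d → ℝ}
    (hφ : IsTestFunction Ω φ) (i : Fin d) : HasCompactSupport (partialDeriv i φ) :=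
  hφ.compact.fderiv_apply (𝕜 := ℝ) _

/-- Integration by parts of a smooth function against a test function. -/
theorem IsTestFunction.setIntegral_mul_partialDeriv {d : ℕ} {Ω : Set (Rd d)} {φ g : Rd d → ℝ}
    (hφ : IsTestFunction Ω φ) (hg : ContDiff ℝ ∞ g) (i : Fin d) :
    ∫ x in Ω, g x * partialDeriv i φ x = -∫ x in Ω, partialDeriv i g x * φ x := by
  have hg' : Continuous (partialDeriv i g) :=
    (hg.continuous_fderiv (by simp)).clm_apply continuous_const
  -- Both integrands vanish off `Ω`, so the integrals extend to the whole space; no regularity of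
  -- the boundary is needed.
  rw [setIntegral_eq_integral_of_forall_compl_eq_zero fun x hx => ?_,
    setIntegral_eq_integral_of_forall_compl_eq_zero fun x hx => ?_]
  · exact integral_mul_fderiv_eq_neg_fderiv_mul_of_integrable
      ((hg'.mul hφ.smooth.continuous).integrable_of_hasCompactSupport hφ.compact.mul_left)
      ((hg.continuous.mul (hφ.continuous_partialDeriv i)).integrable_of_hasCompactSupport
        (hφ.hasCompactSupport_partialDeriv i).mul_left)
      ((hg.continuous.mul hφ.smooth.continuous).integrable_of_hasCompactSupport
        hφ.compact.mul_left)
      (fun x _ => hg.differentiable (by simp) x)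
      (fun x _ => hφ.smooth.differentiable (by simp) x)
  · rw [image_eq_zero_of_notMem_tsupport fun h => hx (hφ.support_subset h), mul_zero]
  · rw [partialDeriv_eq_zero_of_notMem_tsupport fun h => hx (hφ.support_subset h), mul_zero]

/-- The weak partial derivative of a function that is a polynomial on an open subset is there the
partial derivative of the polynomial. -/
theorem IsWeakPartial.ae_eq_polyEval {d : ℕ} {Ω U : Set (Rd d)} (hU : IsOpen U) (hUΩ : U ⊆ Ω)
    {i : Fin d} {v g : L2 Ω} (hv : IsWeakPartial Ω i v g) {P : MvPolynomial (Fin d) ℝ}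
    (hP : ∀ᵐ x ∂(volume.restrict Ω), x ∈ U → v x = polyEval P x) :
    ∀ᵐ x ∂(volume.restrict Ω), x ∈ U → g x = polyEval (MvPolynomial.pderiv i P) x := by
  set Q := MvPolynomial.pderiv i P
  have hg : LocallyIntegrable g (volume.restrict Ω) :=
    (Lp.memLp g).locallyIntegrable (by norm_num)
  have hQ : LocallyIntegrable (polyEval Q) (volume.restrict Ω) :=
    (continuous_polyEval Q).locallyIntegrable
  have key : ∀ᵐ x ∂(volume.restrict Ω), x ∈ U → g x - polyEval Q x = 0 := by
    refine hU.ae_eq_zero_of_integral_contDiff_smul_eq_zero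
      (f := fun x => g x - polyEval Q x) ((hg.sub hQ).locallyIntegrableOn _) ?_
    intro φ h1 h2 h3
    have hφ : IsTestFunction U φ := ⟨h1, h2, h3⟩
    have hφΩ := hφ.mono hUΩ
    -- `φ` is supported in `U`, where `v` is the polynomial, so the two may be exchanged under the
    -- integral.
    have e : ∫ x in Ω, v x * partialDeriv i φ x =
        ∫ x in Ω, polyEval P x * partialDeriv i φ x := by
      refine integral_congr_ae ?_
      filter_upwards [hP] with x hx
      by_cases hxU : x ∈ U
      · rw [hx hxU]
      · rw [partialDeriv_eq_zero_of_notMem_tsupport fun h => hxU (h3 h), mul_zero, mul_zero]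
    have e2 := hφΩ.setIntegral_mul_partialDeriv (contDiff_polyEval P) i
    simp_rw [partialDeriv_polyEval] at e2
    have e3 := hv φ hφΩ
    have hint : Integrable (fun x => polyEval Q x * φ x) (volume.restrict Ω) :=
      ((continuous_polyEval Q).mul h1.continuous).integrable_of_hasCompactSupport h2.mul_left
    have : ∀ x, φ x • (g x - polyEval Q x) = g x * φ x - polyEval Q x * φ x := fun x => by
      simp only [smul_eq_mul]; ring
    simp_rw [this]
    rw [integral_sub (hφΩ.integrable_mul _) hint]
    linarith
  filter_upwards [key] with x hx hxU
  exact sub_eq_zero.1 (hx hxU)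

/-! ### Weak derivatives on `H¹₀(Ω)` and on the discrete space -/

/-- For a fixed test function both sides of the defining identity are `L²` inner products with a
fixed element, hence continuous. -/
theorem isClosed_setOf_isWeakPartial {d : ℕ} (Ω : Set (Rd d)) (i : Fin d) :
    IsClosed {w : L2 Ω × L2 Ω | IsWeakPartial Ω i w.1 w.2} := by
  have hcont : ∀ ψ : Rd d → ℝ, Continuous ψ → HasCompactSupport ψ →
      Continuous fun v : L2 Ω => ∫ x in Ω, v x * ψ x := by
    intro ψ hψ hc
    have hmem : MemLp ψ 2 (volume.restrict Ω) := hψ.memLp_of_hasCompactSupport hc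
    have : (fun v : L2 Ω => ∫ x in Ω, v x * ψ x) = fun v => inner ℝ (hmem.toLp ψ) v := by
      funext v
      rw [L2.inner_def]
      refine integral_congr_ae ?_
      filter_upwards [hmem.coeFn_toLp] with x hx
      simp [hx]
    rw [this]
    fun_prop
  simp only [IsWeakPartial, ofPred_forall]
  refine isClosed_iInter fun φ => isClosed_iInter fun hφ => isClosed_eq ?_ ?_
  · exact (hcont _ (hφ.continuous_partialDeriv i) (hφ.hasCompactSupport_partialDeriv i)).comp
      continuous_fst
  · exact ((hcont _ hφ.smooth.continuous hφ.compact).comp continuous_snd).neg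

/-- Pairs `(φ, ∂_i φ)` satisfy the weak-derivative relation by integration by parts, and the
relation is closed. This ensures that on `H10 Ω` the value of `weakPartial` is never the default
`0`. -/
theorem H10_le_H1 {d : ℕ} (Ω : Set (Rd d)) : H10 Ω ≤ H1 Ω := by
  rintro _ ⟨w, hw, rfl⟩ i
  refine ⟨w.2 i, ?_⟩
  have hcl : IsClosed {w : L2 Ω × L2Vec Ω | IsWeakPartial Ω i w.1 (w.2 i)} :=
    (isClosed_setOf_isWeakPartial Ω i).preimage
      (f := fun w : L2 Ω × L2Vec Ω => (w.1, w.2 i)) (by fun_prop)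
  refine closure_minimal (s := (testGraph Ω : Set (L2 Ω × L2Vec Ω))) ?_ hcl hw
  rintro a ⟨ψ, hψ, h1, h2⟩ φ hφ
  have e1 : ∫ x in Ω, a.1 x * partialDeriv i φ x = ∫ x in Ω, ψ x * partialDeriv i φ x := by
    refine integral_congr_ae ?_
    filter_upwards [h1] with x hx
    rw [hx]
  have e2 : ∫ x in Ω, a.2 i x * φ x = ∫ x in Ω, partialDeriv i ψ x * φ x := by
    refine integral_congr_ae ?_
    filter_upwards [h2 i] with x hx
    rw [hx]
  rw [e1, e2, hφ.setIntegral_mul_partialDeriv hψ.smooth]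

theorem isWeakPartial_of_mem_H1 {d : ℕ} {Ω : Set (Rd d)} {v : L2 Ω} (hv : v ∈ H1 Ω)
    (i : Fin d) : IsWeakPartial Ω i v (weakPartial i v) :=
  isWeakPartial_weakPartial (hv i).choose_spec

theorem weakPartial_add {d : ℕ} {Ω : Set (Rd d)} (hΩ : IsOpen Ω) {v w : L2 Ω} (hv : v ∈ H1 Ω)
    (hw : w ∈ H1 Ω) (i : Fin d) :
    weakPartial i (v + w) = weakPartial i v + weakPartial i w :=
  (isWeakPartial_of_mem_H1 ((H1 Ω).add_mem hv hw) i).unique hΩ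
    ((isWeakPartial_of_mem_H1 hv i).add (isWeakPartial_of_mem_H1 hw i))

theorem weakPartial_smul {d : ℕ} {Ω : Set (Rd d)} (hΩ : IsOpen Ω) {v : L2 Ω} (hv : v ∈ H1 Ω)
    (c : ℝ) (i : Fin d) : weakPartial i (c • v) = c • weakPartial i v :=
  (isWeakPartial_of_mem_H1 ((H1 Ω).smul_mem c hv) i).unique hΩ
    ((isWeakPartial_of_mem_H1 hv i).smul c)

/-- In the interior of a cell the weak derivative is the derivative of the local polynomial; the
boundary of a cell is null because the cell is convex. -/
theorem weakPartial_mem_Pdisc {d : ℕ} {Ω : Set (Rd d)} (hΩ : IsOpen Ω) {𝒯 : Triangulation Ω}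
    {k : ℕ} {v : L2 Ω} (hv : v ∈ Vh 𝒯 k) (i : Fin d) :
    weakPartial i v ∈ Pdisc 𝒯 (k - 1) := by
  intro s hs
  obtain ⟨P, hP, h⟩ := hv.2 s hs
  refine ⟨MvPolynomial.pderiv i P, pderiv_mem_restrictTotalDegree i hP, ?_⟩
  have hint : ∀ᵐ x ∂(volume.restrict Ω),
      x ∈ interior (convexHull ℝ (s : Set (Rd d))) ∩ Ω →
        weakPartial i v x = polyEval (MvPolynomial.pderiv i P) x := by
    refine (isWeakPartial_of_mem_H1 hv.1 i).ae_eq_polyEval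
      (isOpen_interior.inter hΩ) inter_subset_right ?_
    filter_upwards [h] with x hx hxU
    exact hx (interior_subset hxU.1)
  have hfr : ∀ᵐ x ∂(volume.restrict Ω), x ∉ frontier (convexHull ℝ (s : Set (Rd d))) :=
    ae_restrict_of_ae
      (measure_eq_zero_iff_ae_notMem.1 ((convex_convexHull ℝ _).addHaar_frontier volume))
  filter_upwards [hint, hfr, ae_restrict_mem hΩ.measurableSet] with x h1 h2 h3 hx
  exact h1 ⟨by_contra fun hni => h2 ⟨subset_closure hx, hni⟩, h3⟩

/-! ### Weak gradient and divergence as elements of Hilbert spaces -/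

noncomputable section

theorem H10Vec_apply_mem_H1 {d : ℕ} {Ω : Set (Rd d)} {v : L2Vec Ω} (hv : v ∈ H10Vec Ω)
    (i : Fin d) : v i ∈ H1 Ω :=
  H10_le_H1 Ω (hv i)

theorem Vh0Vec_le_H10Vec {d : ℕ} {Ω : Set (Rd d)} (𝒯 : Triangulation Ω) (k : ℕ) :
    Vh0Vec 𝒯 k ≤ H10Vec Ω :=
  fun _ hv i => (hv i).2

/-- The weak gradient `(∂_j v_i)_{i,j}` of a vector field. -/
def weakGrad {d : ℕ} {Ω : Set (Rd d)} (v : L2Vec Ω) : PiLp 2 (fun _ : Fin d × Fin d => L2 Ω) :=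
  WithLp.toLp 2 fun ij => weakPartial ij.2 (v ij.1)

theorem h10Inner_eq_inner_weakGrad {d : ℕ} {Ω : Set (Rd d)} (v w : L2Vec Ω) :
    h10Inner v w = inner ℝ (weakGrad v) (weakGrad w) := by
  rw [PiLp.inner_apply, Fintype.sum_prod_type]
  rfl

theorem h10Norm_eq_norm_weakGrad {d : ℕ} {Ω : Set (Rd d)} (v : L2Vec Ω) :
    h10Norm v = ‖weakGrad v‖ := by
  rw [PiLp.norm_eq_of_L2, Fintype.sum_prod_type]
  rfl

theorem weakGrad_add {d : ℕ} {Ω : Set (Rd d)} (hΩ : IsOpen Ω) {v w : L2Vec Ω}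
    (hv : v ∈ H10Vec Ω) (hw : w ∈ H10Vec Ω) : weakGrad (v + w) = weakGrad v + weakGrad w := by
  ext1 ij
  exact weakPartial_add hΩ (H10Vec_apply_mem_H1 hv _) (H10Vec_apply_mem_H1 hw _) _

theorem weakGrad_smul {d : ℕ} {Ω : Set (Rd d)} (hΩ : IsOpen Ω) {v : L2Vec Ω}
    (hv : v ∈ H10Vec Ω) (c : ℝ) : weakGrad (c • v) = c • weakGrad v := by
  ext1 ij
  exact weakPartial_smul hΩ (H10Vec_apply_mem_H1 hv _) c _

theorem weakGrad_sub {d : ℕ} {Ω : Set (Rd d)} (hΩ : IsOpen Ω) {v w : L2Vec Ω}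
    (hv : v ∈ H10Vec Ω) (hw : w ∈ H10Vec Ω) : weakGrad (v - w) = weakGrad v - weakGrad w := by
  rw [eq_sub_iff_add_eq, ← weakGrad_add hΩ (sub_mem hv hw) hw, sub_add_cancel]

theorem divergence_eq_sum_weakGrad {d : ℕ} {Ω : Set (Rd d)} (v : L2Vec Ω) :
    divergence v = ∑ i, weakGrad v (i, i) := rfl

theorem divergence_sub {d : ℕ} {Ω : Set (Rd d)} (hΩ : IsOpen Ω) {v w : L2Vec Ω}
    (hv : v ∈ H10Vec Ω) (hw : w ∈ H10Vec Ω) :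
    divergence (v - w) = divergence v - divergence w := by
  simp [divergence_eq_sum_weakGrad, weakGrad_sub hΩ hv hw]

theorem divergence_smul {d : ℕ} {Ω : Set (Rd d)} (hΩ : IsOpen Ω) {v : L2Vec Ω}
    (hv : v ∈ H10Vec Ω) (c : ℝ) : divergence (c • v) = c • divergence v := by
  simp [divergence_eq_sum_weakGrad, weakGrad_smul hΩ hv, Finset.smul_sum]

/-- The divergence is the sum of the `d` diagonal entries of the gradient: Cauchy–Schwarz for that
sum gives `√d`, and the off-diagonal entries are dropped. -/
theorem norm_divergence_le {d : ℕ} {Ω : Set (Rd d)} (v : L2Vec Ω) :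
    ‖divergence v‖ ≤ √d * ‖weakGrad v‖ := by
  rw [← Real.sqrt_sq (norm_nonneg (weakGrad v)), ← Real.sqrt_mul (Nat.cast_nonneg d)]
  refine Real.le_sqrt_of_sq_le ?_
  calc ‖divergence v‖ ^ 2 ≤ (∑ i, ‖weakGrad v (i, i)‖) ^ 2 := by
        gcongr
        exact norm_sum_le _ _
    _ ≤ d * ∑ i, ‖weakGrad v (i, i)‖ ^ 2 := by
        simpa using sq_sum_le_card_mul_sum_sq (s := Finset.univ)
          (f := fun i => ‖weakGrad v (i, i)‖)
    _ ≤ d * ‖weakGrad v‖ ^ 2 := by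
        rw [PiLp.norm_sq_eq_of_L2, Fintype.sum_prod_type]
        gcongr with i
        exact Finset.single_le_sum (f := fun j => ‖weakGrad v (i, j)‖ ^ 2)
          (fun j _ => sq_nonneg _) (Finset.mem_univ i)

theorem divergence_mem_Pdisc {d : ℕ} {Ω : Set (Rd d)} (hΩ : IsOpen Ω) {𝒯 : Triangulation Ω}
    {k : ℕ} {v : L2Vec Ω} (hv : v ∈ Vh0Vec 𝒯 k) : divergence v ∈ Pdisc 𝒯 (k - 1) :=
  Submodule.sum_mem _ fun i _ => weakPartial_mem_Pdisc hΩ (hv i).1 i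

/-! ### The pressure projection and mean values -/

theorem inner_projDG {d : ℕ} {Ω : Set (Rd d)} {𝒯 : Triangulation Ω} {k : ℕ} (z : L2 Ω)
    {q : L2 Ω} (hq : q ∈ Pdisc 𝒯 k) : inner ℝ (projDG 𝒯 k z) q = inner ℝ z q := by
  rw [projDG, Submodule.inner_starProjection_left_eq_right,
    Submodule.starProjection_eq_self_iff.2 hq]

theorem sub_mem_L2zmv {d : ℕ} {Ω : Set (Rd d)} (hΩ : Bornology.IsBounded Ω) {p q : L2 Ω}
    (hp : p ∈ L2zmv Ω) (hq : q ∈ L2zmv Ω) : p - q ∈ L2zmv Ω := by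
  have : IsFiniteMeasure (volume.restrict Ω) := ⟨by simpa using hΩ.measure_lt_top⟩
  have hint : ∀ g : L2 Ω, Integrable g (volume.restrict Ω) := fun g =>
    (Lp.memLp g).integrable (by norm_num)
  change ∫ x in Ω, (p - q : L2 Ω) x = 0
  rw [integral_congr_ae (Lp.coeFn_sub p q)]
  simp only [Pi.sub_apply]
  rw [integral_sub (hint p) (hint q), hp, hq, sub_zero]

/-- The mean value is the inner product with the constant `1`, which lies in `L²(Ω)` since `Ω` is
bounded and is fixed by the projection. Hence `pNew - Πz` is an admissible test function in the mass
equation. -/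
theorem projDG_mem_L2zmv {d : ℕ} {Ω : Set (Rd d)} (hΩ : Bornology.IsBounded Ω)
    (𝒯 : Triangulation Ω) (k : ℕ) {z : L2 Ω} (hz : z ∈ L2zmv Ω) :
    projDG 𝒯 k z ∈ L2zmv Ω := by
  have : IsFiniteMeasure (volume.restrict Ω) := ⟨by simpa using hΩ.measure_lt_top⟩
  have hone : MemLp (fun _ : Rd d => (1 : ℝ)) 2 (volume.restrict Ω) := memLp_const 1
  have hinner : ∀ q : L2 Ω, inner ℝ q (hone.toLp _) = ∫ x in Ω, q x := by
    intro q
    rw [L2.inner_def]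
    refine integral_congr_ae ?_
    filter_upwards [hone.coeFn_toLp] with x hx
    rw [hx]
    simp
  have hmem : hone.toLp _ ∈ Pdisc 𝒯 k := by
    intro s _
    refine ⟨MvPolynomial.C 1, by simp [MvPolynomial.mem_restrictTotalDegree], ?_⟩
    filter_upwards [hone.coeFn_toLp] with x hx _
    rw [hx, polyEval_C]
  change ∫ x in Ω, projDG 𝒯 k z x = 0
  rw [← hinner, inner_projDG z hmem, hinner]
  exact hz

/-! ### Error identity and error estimate -/

/-- The velocity of the Stokes problem is inversely proportional to the viscosity. -/
theorem IsStokesSolution.weakGrad_eq_smul {d : ℕ} {Ω : Set (Rd d)} (hΩ : IsOpen Ω) {ν : ℝ}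
    {f : Module.Dual ℝ (H10Vec Ω)} {u w : L2Vec Ω} {p z : L2 Ω}
    (hup : IsStokesSolution Ω ν f u p) (hz : IsStokesSolution Ω 1 f w z) :
    weakGrad w = ν • weakGrad u := by
  have hνu : ν • u ∈ H10Vec Ω := (H10Vec Ω).smul_mem ν hup.velocity_mem
  -- This difference is orthogonal in divergence to all mean-free pressures. As a test function in
  -- both momentum equations it removes `p` and `z`, and subtracting leaves `‖∇(w - νu)‖² = 0`.
  have hmem : w - ν • u ∈ H10Vec Ω := sub_mem hz.velocity_mem hνu
  have hdiv : ∀ q ∈ L2zmv Ω, inner ℝ q (divergence (w - ν • u)) = 0 := by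
    intro q hq
    rw [divergence_sub hΩ hz.velocity_mem hνu, divergence_smul hΩ hup.velocity_mem,
      inner_sub_right, inner_smul_right, hz.mass q hq, hup.mass q hq, mul_zero, sub_zero]
  have h1 := hup.momentum ⟨_, hmem⟩
  have h2 := hz.momentum ⟨_, hmem⟩
  simp only [hdiv p hup.pressure_mem, hdiv z hz.pressure_mem, h10Inner_eq_inner_weakGrad,
    weakGrad_sub hΩ hz.velocity_mem hνu, weakGrad_smul hΩ hup.velocity_mem] at h1 h2
  have h3 : inner ℝ (weakGrad w - ν • weakGrad u) (weakGrad w - ν • weakGrad u) = 0 := by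
    rw [inner_sub_left, real_inner_smul_left]
    linarith
  exact sub_eq_zero.1 (inner_self_eq_zero.1 h3)

/-- With `X = √(a² + b²)`, Cauchy–Schwarz in the plane gives `a + sb ≤ √(1 + s²) X`, and `b ≤ X`. So
`X²` is at most `X` times the bound, and `X` cancels unless it is zero. -/
theorem sqrt_sq_add_sq_le_of_sq_add_sq_le {a b s H D : ℝ} (hH : 0 ≤ H) (hD : 0 ≤ D)
    (h : a ^ 2 + b ^ 2 ≤ a * H + b * (s * H) + b * D) :
    √(a ^ 2 + b ^ 2) ≤ √(1 + s ^ 2) * H + D := by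
  set X := √(a ^ 2 + b ^ 2) with hX
  have hXsq : X ^ 2 = a ^ 2 + b ^ 2 := Real.sq_sqrt (by positivity)
  have h1 : a + s * b ≤ √(1 + s ^ 2) * X := by
    rw [hX, ← Real.sqrt_mul (by positivity)]
    refine Real.le_sqrt_of_sq_le ?_
    nlinarith [sq_nonneg (b - s * a)]
  have h2 : b ≤ X := Real.le_sqrt_of_sq_le (by nlinarith [sq_nonneg a])
  have h3 : X * X ≤ X * (√(1 + s ^ 2) * H + D) := by
    nlinarith [mul_le_mul_of_nonneg_right h1 hH, mul_le_mul_of_nonneg_right h2 hD]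
  rcases (Real.sqrt_nonneg (a ^ 2 + b ^ 2)).eq_or_lt with h0 | h0
  · rw [hX, ← h0]
    positivity
  · exact le_of_mul_le_mul_left h3 h0

/-- The error identity of the discrete problem, tested with the error itself. -/
theorem IsDiscreteSolution.error_identity {d : ℕ} {Ω : Set (Rd d)} (hΩ : IsOpen Ω)
    (hΩ_bdd : Bornology.IsBounded Ω) {𝒯 : Triangulation Ω} {k : ℕ} {ν lam : ℝ}
    {f : Module.Dual ℝ (H10Vec Ω)} {u w uh v : L2Vec Ω} {p z pOld pNew : L2 Ω}
    (hup : IsStokesSolution Ω ν f u p) (hz : IsStokesSolution Ω 1 f w z)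
    (hh : IsDiscreteSolution 𝒯 k ν lam f pOld uh pNew) (hv : v ∈ Vh0Vec 𝒯 k) :
    ν * lam * ‖weakGrad (uh - u)‖ ^ 2 + ν⁻¹ * ‖pNew - projDG 𝒯 (k - 1) z‖ ^ 2 =
      -(ν * lam * inner ℝ (weakGrad (uh - u)) (weakGrad (u - v)))
        + lam * inner ℝ (pNew - projDG 𝒯 (k - 1) z) (divergence (u - v))
        - ν⁻¹ * inner ℝ (pNew - projDG 𝒯 (k - 1) z) (projDG 𝒯 (k - 1) z - pOld) := by
  have hu := hup.velocity_mem
  have huh := Vh0Vec_le_H10Vec 𝒯 k hh.velocity_mem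
  have hvH := Vh0Vec_le_H10Vec 𝒯 k hv
  have hφ : uh - v ∈ Vh0Vec 𝒯 k := sub_mem hh.velocity_mem hv
  have hr : pNew - projDG 𝒯 (k - 1) z ∈ Qh 𝒯 (k - 1) :=
    ⟨sub_mem hh.pressure_mem.1 (Submodule.starProjection_apply_mem _ z),
      sub_mem_L2zmv hΩ_bdd hh.pressure_mem.2
        (projDG_mem_L2zmv hΩ_bdd 𝒯 (k - 1) hz.pressure_mem)⟩
  have h1 := hh.momentum ⟨_, Vh0Vec_le_H10Vec 𝒯 k hφ⟩ hφ
  have h2 := hz.momentum ⟨_, Vh0Vec_le_H10Vec 𝒯 k hφ⟩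
  have h3 := hh.mass _ hr
  have h4 := hup.mass _ hr.2
  -- Replaces `∇w` by `ν∇u` and, since `div φ` is in the range of the projection, `z` by its
  -- projection. Equating the two expressions of `f φ` then gives the orthogonality of the error.
  simp only [h10Inner_eq_inner_weakGrad, hup.weakGrad_eq_smul hΩ hz,
    ← inner_projDG z (divergence_mem_Pdisc hΩ hφ)] at h1 h2
  rw [← h2] at h1
  rw [← real_inner_self_eq_norm_sq, ← real_inner_self_eq_norm_sq]
  simp only [weakGrad_sub hΩ huh hu, weakGrad_sub hΩ hu hvH, weakGrad_sub hΩ huh hvH,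
    divergence_sub hΩ hu hvH, divergence_sub hΩ huh hvH, inner_sub_left, inner_sub_right,
    real_inner_smul_left] at h1 h3 h4 ⊢
  rw [real_inner_comm pNew (projDG 𝒯 (k - 1) z), real_inner_comm pNew pOld,
    real_inner_comm (projDG 𝒯 (k - 1) z) pOld] at *
  -- The momentum equation tested with `uh - v` plus the mass equation tested with `r`; the last
  -- term removes `(r, div u)`.
  linear_combination h1 + h3 - lam * h4

/-- The error estimate with an arbitrary element of the discrete space in place of the projection
of the velocity. -/
theorem IsDiscreteSolution.pairNorm_error_le {d : ℕ} {Ω : Set (Rd d)} (hΩ : IsOpen Ω)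
    (hΩ_bdd : Bornology.IsBounded Ω) {𝒯 : Triangulation Ω} {k : ℕ} {ν lam : ℝ} (hν : 0 < ν)
    (hlam : 0 < lam) {f : Module.Dual ℝ (H10Vec Ω)} {u w uh v : L2Vec Ω} {p z pOld pNew : L2 Ω}
    (hup : IsStokesSolution Ω ν f u p) (hz : IsStokesSolution Ω 1 f w z)
    (hh : IsDiscreteSolution 𝒯 k ν lam f pOld uh pNew) (hv : v ∈ Vh0Vec 𝒯 k) :
    pairNorm (√lam * ν) (uh - u) (pNew - projDG 𝒯 (k - 1) z) ≤
      √(1 + d * lam) * h10Norm (u - v) + (√lam * ν)⁻¹ * ‖projDG 𝒯 (k - 1) z - pOld‖ := by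
  have hid := hh.error_identity hΩ hΩ_bdd hup hz hv
  set r := pNew - projDG 𝒯 (k - 1) z
  set δ := projDG 𝒯 (k - 1) z - pOld
  rw [pairNorm, h10Norm_eq_norm_weakGrad, h10Norm_eq_norm_weakGrad, ← inv_pow, ← mul_pow]
  -- The elementary inequality is used with `s = √(dλ)`, `a = ‖∇(uh - u)‖`, `b = (√λ ν)⁻¹‖r‖`, `H =
  -- ‖∇(u - v)‖` and `D = (√λ ν)⁻¹‖δ‖`.
  have hs : (√d * √lam) ^ 2 = d * lam := by
    rw [mul_pow, Real.sq_sqrt (Nat.cast_nonneg d), Real.sq_sqrt hlam.le]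
  rw [← hs]
  refine sqrt_sq_add_sq_le_of_sq_add_sq_le (norm_nonneg _) (by positivity) ?_
  have h1 := (abs_le.1 (abs_real_inner_le_norm (weakGrad (uh - u)) (weakGrad (u - v)))).1
  have h2 : inner ℝ r (divergence (u - v)) ≤ ‖r‖ * (√d * ‖weakGrad (u - v)‖) :=
    (real_inner_le_norm _ _).trans (by gcongr; exact norm_divergence_le _)
  have h3 := (abs_le.1 (abs_real_inner_le_norm r δ)).1
  have hsq : √lam ^ 2 = lam := Real.sq_sqrt hlam.le
  have hpos : 0 < √lam := Real.sqrt_pos.2 hlam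
  -- Multiplying by `νλ` turns `a² + b²` into the left-hand side of the error identity.
  refine le_of_mul_le_mul_left ?_ (mul_pos hν hlam)
  calc ν * lam * (‖weakGrad (uh - u)‖ ^ 2 + ((√lam * ν)⁻¹ * ‖r‖) ^ 2)
      = ν * lam * ‖weakGrad (uh - u)‖ ^ 2 + ν⁻¹ * ‖r‖ ^ 2 := by
        field_simp
        rw [hsq]
        ring
    _ ≤ ν * lam * (‖weakGrad (uh - u)‖ * ‖weakGrad (u - v)‖)
          + lam * (‖r‖ * (√d * ‖weakGrad (u - v)‖)) + ν⁻¹ * (‖r‖ * ‖δ‖) := by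
        have e1 := mul_le_mul_of_nonneg_left h1 (mul_pos hν hlam).le
        have e2 := mul_le_mul_of_nonneg_left h2 hlam.le
        have e3 := mul_le_mul_of_nonneg_left h3 (inv_pos.2 hν).le
        linarith
    _ = _ := by
        field_simp
        rw [hsq]
        ring

theorem mem_Vh0Vec_of_isPolyOn {d : ℕ} {Ω : Set (Rd d)} (hΩ : IsOpen Ω) (𝒯 : Triangulation Ω)
    {k : ℕ} {u : L2Vec Ω} (hu : u ∈ H10Vec Ω) (hpoly : ∀ i, IsPolyOn k Ω (u i)) :
    u ∈ Vh0Vec 𝒯 k := by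
  refine fun i => ⟨⟨H10Vec_apply_mem_H1 hu i, fun s _ => ?_⟩, hu i⟩
  obtain ⟨P, hP, h⟩ := hpoly i
  refine ⟨P, hP, ?_⟩
  filter_upwards [h, ae_restrict_mem hΩ.measurableSet] with x hx hxΩ _
  exact hx hxΩ

/-- `weakPartial` is defined by choice, so its value at `0` comes from homogeneity with factor `0`.
-/
theorem h10Norm_zero {d : ℕ} {Ω : Set (Rd d)} (hΩ : IsOpen Ω) :
    h10Norm (0 : L2Vec Ω) = 0 := by
  have := weakGrad_smul hΩ (H10Vec Ω).zero_mem 0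
  rw [zero_smul, zero_smul] at this
  rw [h10Norm_eq_norm_weakGrad, this, norm_zero]

end

theorem mainTheorem5 {d : ℕ} (hd : d = 2 ∨ d = 3) {Ω : Set (Rd d)}
    (hΩ_open : IsOpen Ω) (hΩ_conn : IsConnected Ω) (hΩ_bdd : Bornology.IsBounded Ω)
    (𝒯 : Triangulation Ω) {k : ℕ} (hk : 1 ≤ k) {ν lam : ℝ} (hν : 0 < ν) (hlam : 0 < lam)
    {f : Module.Dual ℝ (H10Vec Ω)} (hf : f ∈ HNegOneVec Ω)
    {u : L2Vec Ω} {p : L2 Ω} (hup : IsStokesSolution Ω ν f u p)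
    {w : L2Vec Ω} {z : L2 Ω} (hz : IsStokesSolution Ω 1 f w z)
    {pOld : L2 Ω} (hpOld : pOld ∈ Qh 𝒯 (k - 1))
    {uh : L2Vec Ω} {pNew : L2 Ω} (hh : IsDiscreteSolution 𝒯 k ν lam f pOld uh pNew) :
    pairNorm (√lam * ν) (uh - u) (pNew - projDG 𝒯 (k - 1) z) ≤
        √(1 + d * lam) * h10Norm (u - projCG 𝒯 k u)
          + (√lam * ν)⁻¹ * ‖projDG 𝒯 (k - 1) z - pOld‖ ∧
      ((∀ i, IsPolyOn k Ω (u i)) →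
        projCG 𝒯 k u = u ∧
          pairNorm (√lam * ν) (uh - u) (pNew - projDG 𝒯 (k - 1) z) ≤
            (√lam * ν)⁻¹ * ‖projDG 𝒯 (k - 1) z - pOld‖) := by
  -- For the estimate only membership of the projection in the discrete space matters, not its `L²`
  -- optimality.
  have hmem : projCG 𝒯 k u ∈ Vh0Vec 𝒯 k := Submodule.starProjection_apply_mem _ u
  have hest := hh.pairNorm_error_le hΩ_open hΩ_bdd hν hlam hup hz hmem
  refine ⟨hest, fun hpoly => ?_⟩
  have hu : projCG 𝒯 k u = u := Submodule.starProjection_eq_self_iff.2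
    (mem_Vh0Vec_of_isPolyOn hΩ_open 𝒯 hup.velocity_mem hpoly)
  rw [hu, sub_self, h10Norm_zero hΩ_open, mul_zero, zero_add] at hest
  exact ⟨hu, hest⟩
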